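/- For $0\le \ell\le n$ let $|D^n_\ell\rangle=\binom{n}{\ell}^{-1/2}\sum_{x\in\{0,1\}^n,\ |x|=\ell}|x\rangle$ be the $n$-qubit Dicke state, where $|x|$ is the Hamming weight of $x$. For $1\le k\le n$, a Dicke state unitary $U_{n,k}$ is any unitary on $n$ qubits with $U_{n,k}|0^{n-\ell}1^{\ell}\rangle=|D^n_\ell\rangle$ for all $0\le\ell\le k$. A circuit on $n$ qubits is a sequence of layers; each layer consists of one-qubit and two-qubit gates (arbitrary unitaries) acting on pairwise disjoint sets of qubits, and a two-qubit gate may act on any pair of distinct qubits (all-to-all connectivity). Its depth is the number of layers, its gate count is the number of all its gates. There is an absolute constant $C$ such that for all integers $1\le k\le n$ some circuit on exactly $n$ qubits (no ancilla qubits) implements a Dicke state unitary $U_{n,k}$ exactly, with at most $C\,kn$ gates in total and with depth at most $C\,k\log_2(n/k)$ if $2k\le n$, and at most $C\,k$ if $n<2k$. -/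

import Mathlib

open scoped Matrix

noncomputable section

namespace DickeCircuit

/-- Computational basis labels of `n` qubits. Qubit `i` is the `i`-th bit from the right
(least significant first) of the bitstring in a ket. -/
abbrev Bits (n : ℕ) : Type := Fin n → Bool

/-- State vectors of `n` qubits, in the computational basis. -/
abbrev QState (n : ℕ) : Type := Bits n → ℂ

/-- The computational basis state `|x⟩`. -/
def ket {n : ℕ} (x : Bits n) : QState n := Pi.single x 1

/-- Hamming weight: the number of ones in `x`. -/
def hammingWeight {n : ℕ} (x : Bits n) : ℕ := (Finset.univ.filter fun i => x i = true).card

/-- The bitstring `0^{n-ℓ} 1^ℓ` (for `ℓ ≤ n`): the `ℓ` rightmost bits are one. -/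
def unary (n l : ℕ) : Bits n := fun i => decide (i.val < l)

/-- The Dicke state `|D^n_ℓ⟩`. -/
def dicke (n l : ℕ) : QState n :=
  (((Real.sqrt (n.choose l : ℝ))⁻¹ : ℝ) : ℂ) •
    ∑ x ∈ Finset.univ.filter (fun x : Bits n => hammingWeight x = l), ket x

/-- `U` is a Dicke state unitary `U_{n,k}`. -/
def IsDickeStateUnitary (n k : ℕ) (U : Matrix (Bits n) (Bits n) ℂ) : Prop :=
  U ∈ Matrix.unitaryGroup (Bits n) ℂ ∧ ∀ l ≤ k, U *ᵥ ket (unary n l) = dicke n l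

/-- An elementary gate on an `n`-qubit register: an arbitrary unitary on one qubit, or on any
two distinct qubits (all-to-all connectivity). -/
inductive Gate (n : ℕ) : Type
  | one (p : Fin n) (u : Matrix.unitaryGroup Bool ℂ) : Gate n
  | two (p q : Fin n) (hpq : p ≠ q) (u : Matrix.unitaryGroup (Bool × Bool) ℂ) : Gate n

/-- The qubits on which a gate acts. -/
def Gate.support {n : ℕ} : Gate n → Finset (Fin n)
  | .one p _ => {p}
  | .two p q _ _ => {p, q}

/-- The operator of a gate on the whole register: `u` on the qubits of the gate, tensored with
the identity on all other qubits. -/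
def Gate.toMatrix {n : ℕ} : Gate n → Matrix (Bits n) (Bits n) ℂ
  | .one p u => Matrix.of fun x y =>
      if ∀ i, i ≠ p → x i = y i then (u : Matrix Bool Bool ℂ) (x p) (y p) else 0
  | .two p q _ u => Matrix.of fun x y =>
      if ∀ i, i ≠ p → i ≠ q → x i = y i then
        (u : Matrix (Bool × Bool) (Bool × Bool) ℂ) (x p, x q) (y p, y q)
      else 0

/-- A circuit on exactly `n` qubits (no ancillas): a sequence of layers, where the gates of one
layer act on pairwise disjoint sets of qubits. -/
structure Circuit (n : ℕ) where
  layers : List (List (Gate n))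
  disjoint : ∀ L ∈ layers, L.Pairwise fun g h => Disjoint g.support h.support

/-- The operator of a sequence of gates, the first gate of the list being applied first. -/
def gatesMatrix {n : ℕ} : List (Gate n) → Matrix (Bits n) (Bits n) ℂ
  | [] => 1
  | g :: gs => gatesMatrix gs * g.toMatrix

/-- The operator that a circuit implements, the first layer being applied first. -/
def Circuit.toMatrix {n : ℕ} (c : Circuit n) : Matrix (Bits n) (Bits n) ℂ :=
  gatesMatrix c.layers.flatten

/-- The depth: the number of layers. -/
def Circuit.depth {n : ℕ} (c : Circuit n) : ℕ := c.layers.length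

/-- The total number of gates. -/
def Circuit.gateCount {n : ℕ} (c : Circuit n) : ℕ := c.layers.flatten.length

end DickeCircuit

end

namespace DickeCircuit

/-! ### Local operators and gates -/

/-! Divide and conquer on the weight. For a block of `n₁ + n₂` qubits, Vandermonde's identity writes
the Dicke state of weight `l` as a sum over `i` of an amplitude `amp n₁ n₂ l i` times the Dicke
states of weights `l - i` and `i` on the two parts. So it suffices to send the unary string of
weight `l` to the same superposition of pairs of unary strings, coherently for all `l ≤ K`
(`exists_gates_weightDistribution`), and then to prepare Dicke states on both parts in parallel
(`Realizable.combine`).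

For fixed `l` the distribution is a chain of plane rotations, each moving a single one from the
first part to the second. A unary string reveals its weight locally, at the place where ones turn
into zeros, so four neighbouring qubits suffice as controls and each rotation costs at most 46
gates, whatever `l` and the position (`exists_gates_transfer`). The chain for one `l` sweeps through
both parts like a wave. Waves for successive `l` started four transfers apart do not collide, so
about `K²` transfers fit into depth `O(K)`.

The recursion halves the block, with `K = min k n`. Blocks larger than `k` form about `log (n/k)`
levels of depth `O(k)`, with about `n/k` nodes of `O(k²)` gates each. Inside blocks of size at most
`k` the costs decrease geometrically, giving `O(k²)` gates and depth `O(k)` per block. Depth is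
tracked through clocks of the individual qubits; `exists_layers` converts clock bounds into layers.
-/

/-- `M` acts on the qubits of `S` only. -/
def IsLocal {n : ℕ} (S : Finset (Fin n)) (M : Matrix (Bits n) (Bits n) ℂ) : Prop :=
  (∀ x y, (∃ i ∉ S, x i ≠ y i) → M x y = 0) ∧
  ∀ x y z w, (∀ i ∈ S, x i = z i) → (∀ i ∈ S, y i = w i) →
    (∀ i ∉ S, x i = y i) → (∀ i ∉ S, z i = w i) → M x y = M z w

/-- `overwrite S x z` has the bits of `z` on `S` and those of `x` elsewhere. -/
def overwrite {n : ℕ} (S : Finset (Fin n)) (x z : Bits n) : Bits n :=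
  fun i => if i ∈ S then z i else x i

/-- With disjoint supports only one intermediate string survives in the matrix product: the second
factor cannot alter the bits on `S`, the first cannot alter those off `S`. -/
theorem IsLocal.mul_apply {n : ℕ} {S T : Finset (Fin n)} {M M' : Matrix (Bits n) (Bits n) ℂ}
    (hM : IsLocal S M) (hM' : IsLocal T M') (hST : Disjoint S T) (x z : Bits n) :
    (M * M') x z = M x (overwrite S x z) * M' (overwrite S x z) z := by
  rw [Matrix.mul_apply, Finset.sum_eq_single (overwrite S x z)]
  · intro y _ hy
    by_contra h
    obtain ⟨h1, h2⟩ := mul_ne_zero_iff.1 h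
    refine hy (funext fun i => ?_)
    unfold overwrite
    split_ifs with hi
    · by_contra h3
      exact h2 (hM'.1 y z ⟨i, Finset.disjoint_left.1 hST hi, h3⟩)
    · by_contra h3
      exact h1 (hM.1 x y ⟨i, hi, fun h4 => h3 h4.symm⟩)
  · simp

theorem IsLocal.commute {n : ℕ} {S T : Finset (Fin n)} {M M' : Matrix (Bits n) (Bits n) ℂ}
    (hM : IsLocal S M) (hM' : IsLocal T M') (hST : Disjoint S T) : M * M' = M' * M := by
  ext x z
  rw [hM.mul_apply hM' hST, hM'.mul_apply hM hST.symm]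
  by_cases h : ∃ i, i ∉ S ∧ i ∉ T ∧ x i ≠ z i
  · obtain ⟨i, hS, hT, hi⟩ := h
    rw [hM'.1 _ z ⟨i, hT, by simpa [overwrite, hS] using hi⟩,
      hM.1 _ z ⟨i, hS, by simpa [overwrite, hT] using hi⟩, mul_zero, mul_zero]
  · push Not at h
    have hd := Finset.disjoint_left.1 hST
    rw [mul_comm]
    congr 1
    · apply hM'.2
      · intro i hi
        have : i ∉ S := fun h => hd h hi
        simp [overwrite, this]
      · intro i hi
        simp [overwrite, hi]
      · intro i hi
        by_cases hS : i ∈ S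
        · simp [overwrite, hS]
        · simpa [overwrite, hS] using h i hS hi
      · intro i hi
        simp [overwrite, hi]
    · apply hM.2
      · intro i hi
        have : i ∉ T := hd hi
        simp [overwrite, this]
      · intro i hi
        simp [overwrite, hi]
      · intro i hi
        simp [overwrite, hi]
      · intro i hi
        by_cases hT : i ∈ T
        · simp [overwrite, hT]
        · simpa [overwrite, hT] using h i hi hT

theorem Gate.isLocal {n : ℕ} (g : Gate n) : IsLocal g.support g.toMatrix := by
  cases g with
  | one p u =>
    refine ⟨?_, ?_⟩
    · rintro x y ⟨i, hi, hxy⟩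
      rw [Gate.support, Finset.mem_singleton] at hi
      exact if_neg fun h => hxy (h i hi)
    · intro x y x' y' hx hy h h'
      simp only [Gate.support, Finset.mem_singleton, forall_eq] at hx hy h h'
      simp only [Gate.toMatrix, Matrix.of_apply]
      rw [if_pos h, if_pos h', hx, hy]
  | two p q hpq u =>
    refine ⟨?_, ?_⟩
    · rintro x y ⟨i, hi, hxy⟩
      rw [Gate.support, Finset.mem_insert, Finset.mem_singleton, not_or] at hi
      exact if_neg fun h => hxy (h i hi.1 hi.2)
    · intro x y x' y' hx hy h h'
      simp only [Gate.support, Finset.mem_insert, Finset.mem_singleton, forall_eq_or_imp,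
        forall_eq, not_or, and_imp] at hx hy h h'
      simp only [Gate.toMatrix, Matrix.of_apply]
      rw [if_pos h, if_pos h', hx.1, hx.2, hy.1, hy.2]

theorem Gate.toMatrix_mul_comm {n : ℕ} {g h : Gate n} (hgh : Disjoint g.support h.support) :
    g.toMatrix * h.toMatrix = h.toMatrix * g.toMatrix :=
  g.isLocal.commute h.isLocal hgh

theorem Gate.one_mulVec {n : ℕ} (p : Fin n) (u : Matrix.unitaryGroup Bool ℂ) (ψ : QState n)
    (x : Bits n) : ((Gate.one p u).toMatrix *ᵥ ψ) x =
      ∑ b : Bool, (u : Matrix Bool Bool ℂ) (x p) b * ψ (Function.update x p b) := by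
  simp only [Matrix.mulVec, dotProduct]
  have hinj : Function.Injective fun b : Bool => Function.update x p b :=
    Function.update_injective x p
  rw [← Finset.sum_subset (Finset.subset_univ (Finset.univ.map ⟨_, hinj⟩)), Finset.sum_map]
  · refine Finset.sum_congr rfl fun b _ => ?_
    simp only [Gate.toMatrix, Matrix.of_apply, Function.Embedding.coeFn_mk,
      Function.update_self]
    rw [if_pos fun i hi => by rw [Function.update_of_ne hi]]
  · intro y _ hy
    simp only [Gate.toMatrix, Matrix.of_apply]
    rw [if_neg, zero_mul]
    intro h
    refine hy (Finset.mem_map.2 ⟨y p, Finset.mem_univ _, funext fun i => ?_⟩)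
    by_cases hi : i = p
    · subst hi; simp
    · simp [hi, h i hi]

theorem Gate.two_mulVec {n : ℕ} (p q : Fin n) (hpq : p ≠ q)
    (u : Matrix.unitaryGroup (Bool × Bool) ℂ) (ψ : QState n) (x : Bits n) :
    ((Gate.two p q hpq u).toMatrix *ᵥ ψ) x =
      ∑ b : Bool × Bool, (u : Matrix (Bool × Bool) (Bool × Bool) ℂ) (x p, x q) b *
        ψ (Function.update (Function.update x p b.1) q b.2) := by
  simp only [Matrix.mulVec, dotProduct]
  have hinj : Function.Injective fun b : Bool × Bool =>
      Function.update (Function.update x p b.1) q b.2 := by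
    rintro ⟨b, b'⟩ ⟨c, c'⟩ h
    have h1 := congrFun h p
    have h2 := congrFun h q
    simp [hpq] at h1 h2
    simp [h1, h2]
  rw [← Finset.sum_subset (Finset.subset_univ (Finset.univ.map ⟨_, hinj⟩)), Finset.sum_map]
  · refine Finset.sum_congr rfl fun b _ => ?_
    simp only [Gate.toMatrix, Matrix.of_apply, Function.Embedding.coeFn_mk,
      Function.update_self, Function.update_of_ne hpq]
    rw [if_pos fun i hi hi' => by rw [Function.update_of_ne hi', Function.update_of_ne hi]]
  · intro y _ hy
    simp only [Gate.toMatrix, Matrix.of_apply]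
    rw [if_neg, zero_mul]
    intro h
    refine hy (Finset.mem_map.2 ⟨(y p, y q), Finset.mem_univ _, funext fun i => ?_⟩)
    by_cases hi : i = p
    · subst hi; simp [hpq]
    · by_cases hi' : i = q
      · subst hi'; simp
      · simp [hi, hi', h i hi hi']

theorem matrix_ext_mulVec {n : ℕ} {A B : Matrix (Bits n) (Bits n) ℂ}
    (h : ∀ ψ : QState n, A *ᵥ ψ = B *ᵥ ψ) : A = B :=
  Matrix.mulVec_injective (funext h)

theorem Gate.toMatrix_mem_unitaryGroup {n : ℕ} (g : Gate n) :
    g.toMatrix ∈ Matrix.unitaryGroup (Bits n) ℂ := by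
  rw [Matrix.mem_unitaryGroup_iff]
  cases g with
  | one p u =>
    have hs : star (Gate.one p u).toMatrix = (Gate.one p (star u)).toMatrix := by
      ext x y
      have : (∀ i, i ≠ p → y i = x i) ↔ ∀ i, i ≠ p → x i = y i := by simp only [eq_comm]
      simp only [Gate.toMatrix, Matrix.star_apply, Matrix.of_apply, this]
      by_cases h : ∀ i, i ≠ p → x i = y i
      · rw [if_pos h, if_pos h]; rfl
      · rw [if_neg h, if_neg h, star_zero]
    rw [hs]
    refine matrix_ext_mulVec fun ψ => funext fun x => ?_
    rw [← Matrix.mulVec_mulVec, Gate.one_mulVec, Matrix.one_mulVec]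
    simp only [Gate.one_mulVec, Function.update_self, Function.update_idem, Finset.mul_sum]
    rw [Finset.sum_comm]
    have hu := Matrix.mem_unitaryGroup_iff.1 u.2
    simp only [← mul_assoc, ← Finset.sum_mul]
    have : ∀ b, ∑ c, (u : Matrix Bool Bool ℂ) (x p) c * (↑(star u) : Matrix Bool Bool ℂ) c b
        = (1 : Matrix Bool Bool ℂ) (x p) b := by
      intro b
      rw [← hu, Matrix.mul_apply]; rfl
    simp only [this, Matrix.one_apply, ite_mul, one_mul, zero_mul, Finset.sum_ite_eq,
      Finset.mem_univ, if_true, Function.update_eq_self]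
  | two p q hpq u =>
    have hs : star (Gate.two p q hpq u).toMatrix = (Gate.two p q hpq (star u)).toMatrix := by
      ext x y
      have : (∀ i, i ≠ p → i ≠ q → y i = x i) ↔ ∀ i, i ≠ p → i ≠ q → x i = y i := by
        simp only [eq_comm]
      simp only [Gate.toMatrix, Matrix.star_apply, Matrix.of_apply, this]
      by_cases h : ∀ i, i ≠ p → i ≠ q → x i = y i
      · rw [if_pos h, if_pos h]; rfl
      · rw [if_neg h, if_neg h, star_zero]
    rw [hs]
    refine matrix_ext_mulVec fun ψ => funext fun x => ?_
    rw [← Matrix.mulVec_mulVec, Gate.two_mulVec, Matrix.one_mulVec]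
    have hupd : ∀ b c : Bool × Bool, Function.update (Function.update
        (Function.update (Function.update x p b.1) q b.2) p c.1) q c.2 =
        Function.update (Function.update x p c.1) q c.2 := by
      intro b c
      rw [Function.update_comm hpq.symm, Function.update_idem, Function.update_idem]
    simp only [Gate.two_mulVec, Function.update_self, Function.update_of_ne hpq, hupd,
      Finset.mul_sum]
    rw [Finset.sum_comm]
    have hu := Matrix.mem_unitaryGroup_iff.1 u.2
    simp only [← mul_assoc, ← Finset.sum_mul]
    have : ∀ b, ∑ c, (u : Matrix (Bool × Bool) (Bool × Bool) ℂ) (x p, x q) c *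
        (↑(star u) : Matrix (Bool × Bool) (Bool × Bool) ℂ) c b
        = (1 : Matrix (Bool × Bool) (Bool × Bool) ℂ) (x p, x q) b := by
      intro b
      rw [← hu, Matrix.mul_apply]; rfl
    simp only [this, Matrix.one_apply, ite_mul, one_mul, zero_mul, Finset.sum_ite_eq,
      Finset.mem_univ, if_true, Function.update_eq_self]

theorem gatesMatrix_append {n : ℕ} (gs hs : List (Gate n)) :
    gatesMatrix (gs ++ hs) = gatesMatrix hs * gatesMatrix gs := by
  induction gs with
  | nil => simp [gatesMatrix]
  | cons g gs ih => simp [gatesMatrix, ih, mul_assoc]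

theorem gatesMatrix_singleton {n : ℕ} (g : Gate n) : gatesMatrix [g] = g.toMatrix := by
  simp [gatesMatrix]

theorem gatesMatrix_mem_unitaryGroup {n : ℕ} (gs : List (Gate n)) :
    gatesMatrix gs ∈ Matrix.unitaryGroup (Bits n) ℂ := by
  induction gs with
  | nil => exact one_mem _
  | cons g gs ih => exact mul_mem ih g.toMatrix_mem_unitaryGroup

theorem gatesMatrix_mul_comm {n : ℕ} {g : Gate n} {gs : List (Gate n)}
    (h : ∀ g' ∈ gs, Disjoint g.support g'.support) :
    gatesMatrix gs * g.toMatrix = g.toMatrix * gatesMatrix gs := by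
  induction gs with
  | nil => simp [gatesMatrix]
  | cons g' gs ih =>
    simp only [List.mem_cons, forall_eq_or_imp] at h
    rw [gatesMatrix, mul_assoc, ← Gate.toMatrix_mul_comm h.1, ← mul_assoc, ih h.2, mul_assoc]

/-! ### Scheduling a gate list into layers -/

/-- The clocks of the qubits after a gate that waits for all of its qubits and takes one unit
of time. -/
def tick {n : ℕ} (c : Fin n → ℕ) (g : Gate n) : Fin n → ℕ :=
  fun q => if q ∈ g.support then g.support.sup c + 1 else c q

/-- The clocks of the qubits after a list of gates, each executed as soon as possible. -/
def clock {n : ℕ} (gs : List (Gate n)) (c : Fin n → ℕ) : Fin n → ℕ := gs.foldl tick c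

theorem clock_append {n : ℕ} (gs hs : List (Gate n)) (c : Fin n → ℕ) :
    clock (gs ++ hs) c = clock hs (clock gs c) := List.foldl_append

theorem le_tick {n : ℕ} (c : Fin n → ℕ) (g : Gate n) : c ≤ tick c g := by
  intro q
  unfold tick
  split_ifs with h
  · exact (Finset.le_sup (f := c) h).trans (Nat.le_succ _)
  · exact le_rfl

theorem clock_of_notMem {n : ℕ} {gs : List (Gate n)} {S : Finset (Fin n)}
    (hS : ∀ g ∈ gs, g.support ⊆ S) (c : Fin n → ℕ) {q : Fin n} (hq : q ∉ S) :
    clock gs c q = c q := by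
  induction gs generalizing c with
  | nil => rfl
  | cons g gs ih =>
    simp only [List.mem_cons, forall_eq_or_imp] at hS
    change clock gs (tick c g) q = _
    rw [ih hS.2, tick, if_neg fun h => hq (hS.1 h)]

/-- The crude bound without any parallelism; it is used only inside a single transfer, where the
number of gates is constant. -/
theorem clock_le_add_length {n : ℕ} {gs : List (Gate n)} {S : Finset (Fin n)}
    (hS : ∀ g ∈ gs, g.support ⊆ S) {c : Fin n → ℕ} {t : ℕ} (hc : ∀ q ∈ S, c q ≤ t)
    {q : Fin n} (hq : q ∈ S) : clock gs c q ≤ t + gs.length := by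
  induction gs generalizing c t with
  | nil => exact hc q hq
  | cons g gs ih =>
    simp only [List.mem_cons, forall_eq_or_imp] at hS
    have := ih (c := tick c g) (t := t + 1) hS.2 (fun r hr => by
      unfold tick
      split_ifs
      · exact Nat.succ_le_succ (Finset.sup_le fun i hi => hc i (hS.1 hi))
      · exact (hc r hr).trans (Nat.le_succ t))
    rw [List.length_cons]
    change clock gs (tick c g) q ≤ _
    omega

/-- Greedy scheduling. The last conjunct is the invariant that drives the induction: a qubit is idle
in every layer from its clock value onwards, so a new gate fits into the layer indexed by the
largest clock on its support and commutes past all later layers. -/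
theorem exists_layers {n D : ℕ} (gs : List (Gate n)) (h : ∀ q, clock gs 0 q ≤ D) :
    ∃ layers : List (List (Gate n)), layers.length = D ∧
      (∀ L ∈ layers, L.Pairwise fun g h => Disjoint g.support h.support) ∧
      gatesMatrix layers.flatten = gatesMatrix gs ∧ layers.flatten.length = gs.length ∧
      ∀ q, ∀ L ∈ layers.drop (clock gs 0 q), ∀ g ∈ L, q ∉ g.support := by
  induction gs using List.reverseRecOn with
  | nil =>
    refine ⟨List.replicate D [], by simp, ?_, by simp, by simp, ?_⟩
    · intro L hL
      rw [List.eq_of_mem_replicate hL]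
      exact List.Pairwise.nil
    · intro q L hL g hg
      rw [List.eq_of_mem_replicate (List.mem_of_mem_drop hL)] at hg
      simp at hg
  | append_singleton gs g ih =>
    have hcl : clock (gs ++ [g]) 0 = tick (clock gs 0) g := clock_append _ _ _
    rw [hcl] at h ⊢
    obtain ⟨layers, hlen, hdis, hmat, hcount, hdrop⟩ :=
      ih fun q => (le_tick _ g q).trans (h q)
    set c := clock gs 0
    set t := g.support.sup c with ht
    have htD : t < D := by
      have : g.support.Nonempty := by cases g <;> simp [Gate.support]
      obtain ⟨q, hq⟩ := this
      have := h q
      rw [tick, if_pos hq] at this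
      omega
    have htl : t < layers.length := hlen ▸ htD
    have hsplit : layers = layers.take t ++ (layers[t] :: layers.drop (t + 1)) := by
      rw [← List.drop_eq_getElem_cons htl, List.take_append_drop]
    have hfree : ∀ L ∈ layers.drop t, ∀ g' ∈ L, Disjoint g.support g'.support := by
      intro L hL g' hg'
      refine Finset.disjoint_left.2 fun q hq => hdrop q L ?_ g' hg'
      have hle : c q ≤ t := Finset.le_sup (f := c) hq
      have : layers.drop t = (layers.drop (c q)).drop (t - c q) := by
        rw [List.drop_drop]; congr 1; omega
      rw [this] at hL
      exact List.mem_of_mem_drop hL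
    have hmem : layers[t] ∈ layers.drop t := by
      rw [List.drop_eq_getElem_cons htl]; exact List.mem_cons_self
    have hdrop1 : ∀ L ∈ layers.drop (t + 1), L ∈ layers.drop t := by
      intro L hL
      rw [List.drop_eq_getElem_cons htl]; exact List.mem_cons_of_mem _ hL
    refine ⟨layers.take t ++ ((layers[t] ++ [g]) :: layers.drop (t + 1)), ?_, ?_, ?_, ?_, ?_⟩
    · simp only [List.length_append, List.length_take, List.length_cons, List.length_drop]
      omega
    · intro L hL
      rw [List.mem_append, List.mem_cons] at hL
      rcases hL with hL | rfl | hL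
      · exact hdis L (List.mem_of_mem_take hL)
      · rw [List.pairwise_append]
        refine ⟨hdis _ (List.getElem_mem htl), List.pairwise_singleton _ _, ?_⟩
        intro a ha b hb
        rw [List.mem_singleton.1 hb]
        exact (hfree _ hmem a ha).symm
      · exact hdis L (List.mem_of_mem_drop hL)
    · rw [gatesMatrix_append, gatesMatrix_singleton, ← hmat]
      conv_rhs => rw [hsplit]
      simp only [List.flatten_append, List.flatten_cons, gatesMatrix_append,
        gatesMatrix_singleton]
      have : gatesMatrix (layers.drop (t + 1)).flatten * g.toMatrix =
          g.toMatrix * gatesMatrix (layers.drop (t + 1)).flatten := by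
        apply gatesMatrix_mul_comm
        intro g' hg'
        obtain ⟨L, hL, hg'⟩ := List.mem_flatten.1 hg'
        exact hfree L (hdrop1 L hL) g' hg'
      simp only [← mul_assoc, this]
    · rw [List.length_append, ← hcount]
      conv_rhs => rw [hsplit]
      simp only [List.flatten_append, List.flatten_cons, List.length_append,
        List.length_singleton]
      omega
    · intro q L hL g' hg'
      unfold tick at hL
      have hlt : (layers.take t).length = t := by simp [htl.le]
      split_ifs at hL with hq
      · have : (layers.take t ++ ((layers[t] ++ [g]) :: layers.drop (t + 1))).drop (t + 1) =
            layers.drop (t + 1) := by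
          rw [List.drop_append, hlt]
          simp
        rw [this] at hL
        exact Finset.disjoint_left.1 (hfree L (hdrop1 L hL) g' hg') hq
      · have hq' : ∀ L' ∈ layers.drop (c q), ∀ g'' ∈ L', q ∉ g''.support := hdrop q
        rw [List.drop_append, hlt, List.mem_append] at hL
        rcases hL with hL | hL
        · refine hq' L ?_ g' hg'
          rw [hsplit, List.drop_append]
          exact List.mem_append_left _ hL
        · rcases Nat.eq_zero_or_pos (c q - t) with h0 | h0
          · rw [h0, List.drop_zero, List.mem_cons] at hL
            have hsub : ∀ L' ∈ layers.drop t, L' ∈ layers.drop (c q) := by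
              intro L' hL'
              have : layers.drop t = (layers.drop (c q)).drop (t - c q) := by
                rw [List.drop_drop]; congr 1; omega
              rw [this] at hL'
              exact List.mem_of_mem_drop hL'
            rcases hL with rfl | hL
            · rw [List.mem_append, List.mem_singleton] at hg'
              rcases hg' with hg' | rfl
              · exact hq' _ (hsub _ hmem) g' hg'
              · exact hq
            · exact hq' L (hsub L (hdrop1 L hL)) g' hg'
          · refine hq' L ?_ g' hg'
            obtain ⟨m, hm⟩ : ∃ m, c q - t = m + 1 := ⟨_, (Nat.succ_pred_eq_of_pos h0).symm⟩
            rw [hm, List.drop_succ_cons, List.drop_drop] at hL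
            convert hL using 2
            omega

theorem exists_circuit {n D : ℕ} (gs : List (Gate n)) (h : ∀ q, clock gs 0 q ≤ D) :
    ∃ c : Circuit n, c.toMatrix = gatesMatrix gs ∧ c.gateCount = gs.length ∧ c.depth = D := by
  obtain ⟨layers, hlen, hdis, hmat, hcount, -⟩ := exists_layers gs h
  exact ⟨⟨layers, hdis⟩, hmat, hcount, hlen⟩

/-! ### Multiplexed two-qubit rotations -/

/-- The operator that rotates by the angle `θ x` in the plane spanned by `|x⟩` and the basis
state obtained from it by exchanging the bits `p` and `q`, if these bits differ. -/
noncomputable def pairRot {n : ℕ} (p q : Fin n) (θ : Bits n → ℝ) (ψ : QState n) : QState n :=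
  fun x => if x p = x q then ψ x else
    (Real.cos (θ x) : ℂ) * ψ x +
      ((if x p then -Real.sin (θ x) else Real.sin (θ x) : ℝ) : ℂ) * ψ (x ∘ Equiv.swap p q)

/-- The rotation in the span of `|10⟩` and `|01⟩`. -/
noncomputable def rotMatrix (α : ℝ) : Matrix (Bool × Bool) (Bool × Bool) ℂ :=
  Matrix.of fun a b => if a.1 = a.2 then (if b = a then 1 else 0) else
    if b = a then (Real.cos α : ℂ) else if b = a.swap then
      ((if a.1 then -Real.sin α else Real.sin α : ℝ) : ℂ) else 0

/-- The controlled sign change. -/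
def czMatrix : Matrix (Bool × Bool) (Bool × Bool) ℂ :=
  Matrix.diagonal fun a => if a.1 && a.2 then -1 else 1

theorem rotMatrix_mem (α : ℝ) : rotMatrix α ∈ Matrix.unitaryGroup (Bool × Bool) ℂ := by
  have h : (Complex.cos α) * (Complex.cos α) + (Complex.sin α) * (Complex.sin α) = 1 := by
    rw [← sq, ← sq, add_comm, Complex.sin_sq_add_cos_sq]
  have hc : (starRingEnd ℂ) (Complex.cos α) = Complex.cos α := by
    rw [← Complex.cos_conj, Complex.conj_ofReal]
  have hs : (starRingEnd ℂ) (Complex.sin α) = Complex.sin α := by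
    rw [← Complex.sin_conj, Complex.conj_ofReal]
  rw [Matrix.mem_unitaryGroup_iff]
  ext ⟨a, b⟩ ⟨c, d⟩
  cases a <;> cases b <;> cases c <;> cases d <;>
    simp [Matrix.mul_apply, rotMatrix, Fintype.sum_prod_type, Matrix.star_apply, hc, hs, h,
      add_comm, mul_comm]

theorem czMatrix_mem : czMatrix ∈ Matrix.unitaryGroup (Bool × Bool) ℂ := by
  rw [Matrix.mem_unitaryGroup_iff]
  ext ⟨a, b⟩ ⟨c, d⟩
  cases a <;> cases b <;> cases c <;> cases d <;>
    simp [Matrix.mul_apply, czMatrix, Matrix.star_apply, Matrix.diagonal_apply]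

theorem update_update_eq_swap {n : ℕ} {p q : Fin n} (x : Bits n) :
    Function.update (Function.update x p (x q)) q (x p) = x ∘ Equiv.swap p q := by
  funext i
  by_cases hq : i = q
  · subst hq; simp
  · by_cases hp : i = p
    · subst hp; simp [hq]
    · simp [hp, hq, Equiv.swap_apply_of_ne_of_ne]

theorem rot_mulVec {n : ℕ} {p q : Fin n} (hpq : p ≠ q) (α : ℝ) (ψ : QState n) :
    (Gate.two p q hpq ⟨rotMatrix α, rotMatrix_mem α⟩).toMatrix *ᵥ ψ =
      pairRot p q (fun _ => α) ψ := by
  funext x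
  rw [Gate.two_mulVec, pairRot, ← update_update_eq_swap]
  have hx : ψ x = ψ (Function.update (Function.update x p (x p)) q (x q)) := by simp
  simp only [hx]
  generalize x p = a
  generalize x q = b
  cases a <;> cases b <;> simp [rotMatrix, Fintype.sum_prod_type, add_comm]

theorem cz_mulVec {n : ℕ} {p q : Fin n} (hpq : p ≠ q) (ψ : QState n) :
    (Gate.two p q hpq ⟨czMatrix, czMatrix_mem⟩).toMatrix *ᵥ ψ =
      fun x => (if x p && x q then -1 else 1) * ψ x := by
  funext x
  rw [Gate.two_mulVec]
  have hx : ψ x = ψ (Function.update (Function.update x p (x p)) q (x q)) := by simp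
  simp only [hx]
  generalize x p = a
  generalize x q = b
  cases a <;> cases b <;> simp [czMatrix, Matrix.diagonal_apply]

/-- A sign change on `p` anticommutes with the generator of the rotation, so conjugation by the
controlled sign change reverses the angle `v` exactly when the control bit `c` is set. -/
theorem pairRot_signed {n : ℕ} {p q c : Fin n} (hcp : c ≠ p) (hcq : c ≠ q)
    (u v : Bits n → ℝ) (hu : ∀ x, u (x ∘ Equiv.swap p q) = u x) (ψ : QState n) :
    (fun x : Bits n => (if x c && x p then (-1 : ℂ) else 1) *
      pairRot p q v (fun x => (if x c && x p then -1 else 1) * pairRot p q u ψ x) x) =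
    pairRot p q (fun x => u x + (if x c then -1 else 1) * v x) ψ := by
  funext x
  have hc : (x ∘ Equiv.swap p q) c = x c := by
    simp [Equiv.swap_apply_of_ne_of_ne hcp hcq]
  have hs : (x ∘ Equiv.swap p q) ∘ Equiv.swap p q = x := by
    funext i; simp
  simp only [pairRot, hc, hs, hu, Function.comp_apply, Equiv.swap_apply_left,
    Equiv.swap_apply_right]
  cases hxc : x c <;> cases hxp : x p <;> cases hxq : x q <;>
    simp [Real.cos_add, Real.sin_add] <;> ring

theorem exists_gates_pairRot {n : ℕ} {p q : Fin n} (hpq : p ≠ q) (cs : Finset (Fin n))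
    (hp : p ∉ cs) (hq : q ∉ cs) (θ : Bits n → ℝ)
    (hθ : ∀ x y : Bits n, (∀ i ∈ cs, x i = y i) → θ x = θ y) :
    ∃ gs : List (Gate n), (∀ ψ, gatesMatrix gs *ᵥ ψ = pairRot p q θ ψ) ∧
      gs.length + 2 = 3 * 2 ^ cs.card ∧ ∀ g ∈ gs, g.support ⊆ insert p (insert q cs) := by
  induction cs using Finset.induction_on generalizing θ with
  | empty =>
    refine ⟨[Gate.two p q hpq ⟨rotMatrix (θ 0), rotMatrix_mem _⟩], ?_, by simp, ?_⟩
    · intro ψ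
      rw [gatesMatrix_singleton, rot_mulVec]
      congr 1
      funext x
      exact hθ _ _ (by simp)
    · simp [Gate.support]
  | insert c cs hc ih =>
    rw [Finset.mem_insert, not_or] at hp hq
    have hval : ∀ b b' : Bool, ∀ x y : Bits n, (∀ i ∈ cs, x i = y i) → b = b' →
        θ (Function.update x c b) = θ (Function.update y c b') := by
      rintro b _ x y h rfl
      apply hθ
      intro i hi
      by_cases hic : i = c
      · subst hic; simp
      · simp [hic, h i (Finset.mem_of_mem_insert_of_ne hi hic)]
    -- Solves `u + v = θ` at control bit 0 and `u - v = θ` at control bit 1. Two recursive calls and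
    -- two sign gates give the length recursion `L ↦ 2 L + 2`, hence `L + 2 = 3 * 2 ^ card`.
    let u : Bits n → ℝ := fun x =>
      (θ (Function.update x c false) + θ (Function.update x c true)) / 2
    let v : Bits n → ℝ := fun x =>
      (θ (Function.update x c false) - θ (Function.update x c true)) / 2
    have hu : ∀ x y : Bits n, (∀ i ∈ cs, x i = y i) → u x = u y := fun x y h => by
      simp only [u, hval _ _ x y h rfl]
    have hv : ∀ x y : Bits n, (∀ i ∈ cs, x i = y i) → v x = v y := fun x y h => by
      simp only [v, hval _ _ x y h rfl]
    obtain ⟨gu, hgu, hlu, hsu⟩ := ih hp.2 hq.2 u hu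
    obtain ⟨gv, hgv, hlv, hsv⟩ := ih hp.2 hq.2 v hv
    have hcp : c ≠ p := Ne.symm hp.1
    have hcq : c ≠ q := Ne.symm hq.1
    have hsub : insert p (insert q cs) ⊆ insert p (insert q (insert c cs)) :=
      Finset.insert_subset_insert _ (Finset.insert_subset_insert _ (Finset.subset_insert _ _))
    let z : Gate n := Gate.two c p hcp ⟨czMatrix, czMatrix_mem⟩
    have hz : z.support ⊆ insert p (insert q (insert c cs)) := by
      intro i hi
      simp only [z, Gate.support, Finset.mem_insert, Finset.mem_singleton] at hi ⊢
      tauto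
    refine ⟨gu ++ ([z] ++ (gv ++ [z])), ?_, ?_, ?_⟩
    · intro ψ
      simp only [gatesMatrix_append, gatesMatrix_singleton, ← Matrix.mulVec_mulVec, hgu, hgv,
        z, cz_mulVec]
      rw [pairRot_signed hcp hcq]
      · congr 1
        funext x
        cases hx : x c
        · have : Function.update x c false = x := by rw [← hx, Function.update_eq_self]
          simp [u, v, this]; ring
        · have : Function.update x c true = x := by rw [← hx, Function.update_eq_self]
          simp [u, v, this]; ring
      · intro x
        apply hu
        intro i hi
        have h1 : i ≠ p := fun h => hp.2 (h ▸ hi)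
        have h2 : i ≠ q := fun h => hq.2 (h ▸ hi)
        simp [Equiv.swap_apply_of_ne_of_ne h1 h2]
    · simp only [List.length_append, List.length_singleton, Finset.card_insert_of_notMem hc,
        pow_succ]
      omega
    · intro g hg
      simp only [List.mem_append, List.mem_singleton] at hg
      rcases hg with h | rfl | h | rfl
      · exact (hsu g h).trans hsub
      · exact hz
      · exact (hsv g h).trans hsub
      · exact hz

theorem pairRot_ket_of_eq_zero {n : ℕ} (p q : Fin n) {θ : Bits n → ℝ}
    (hs : ∀ x, θ (x ∘ Equiv.swap p q) = θ x) {y : Bits n} (hy : y p = y q ∨ θ y = 0) :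
    pairRot p q θ (ket y) = ket y := by
  funext x
  have hss : (x ∘ Equiv.swap p q) ∘ Equiv.swap p q = x := by
    funext i; simp
  rw [pairRot]
  by_cases h : x p = x q
  · rw [if_pos h]
  · rw [if_neg h]
    by_cases h1 : x = y
    · subst h1
      have h0 := hy.resolve_left h
      simp [h0]
    · by_cases h2 : x ∘ Equiv.swap p q = y
      · have h3 : θ x = 0 := by
          rcases hy with hy | hy
          · rw [← h2] at hy
            simp at hy
            exact absurd hy.symm h
          · rw [← hs, h2, hy]
        simp [h3]
      · simp [ket, h1, h2]

theorem pairRot_ket {n : ℕ} {p q : Fin n} {θ : Bits n → ℝ}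
    (hs : ∀ x, θ (x ∘ Equiv.swap p q) = θ x) {y : Bits n} (hp : y p = true) (hq : y q = false) :
    pairRot p q θ (ket y) = (Real.cos (θ y) : ℂ) • ket y +
      (Real.sin (θ y) : ℂ) • ket (y ∘ Equiv.swap p q) := by
  funext x
  have hss : ∀ x : Bits n, (x ∘ Equiv.swap p q) ∘ Equiv.swap p q = x := by
    intro x; funext i; simp
  have hne : y ≠ y ∘ Equiv.swap p q := by
    intro h
    have := congrFun h p
    simp [hp, hq] at this
  rw [pairRot]
  by_cases h1 : x = y
  · subst h1
    simp [hp, hq, ket, hne, hne.symm]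
  · by_cases h2 : x = y ∘ Equiv.swap p q
    · subst h2
      simp [hp, hq, ket, hne.symm, hs, hss]
    · have h3 : x ∘ Equiv.swap p q ≠ y := fun h => h2 (by rw [← h, hss])
      simp [ket, h1, h2, h3]

/-! ### Distributing the weight of a unary string over two adjacent blocks -/

/-- The bitstring whose block `[o, o + n₁)` starts with `a` ones, whose block
`[o + n₁, o + n₁ + n₂)` starts with `b` ones, which is zero elsewhere on these two blocks and
equal to `y` outside of them. -/
def splitUnary {N : ℕ} (o n₁ n₂ a b : ℕ) (y : Bits N) : Bits N := fun q =>
  if o ≤ (q : ℕ) ∧ (q : ℕ) < o + (n₁ + n₂) then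
    decide ((q : ℕ) < o + a ∨ (o + n₁ ≤ (q : ℕ) ∧ (q : ℕ) < o + n₁ + b)) else y q

theorem splitUnary_left {N o n₁ n₂ a b : ℕ} (y : Bits N) {q : Fin N} (h : o ≤ (q : ℕ))
    (h' : (q : ℕ) < o + n₁) : splitUnary o n₁ n₂ a b y q = decide ((q : ℕ) < o + a) := by
  rw [splitUnary, if_pos (by omega), decide_eq_decide]
  omega

theorem splitUnary_right {N o n₁ n₂ a b : ℕ} (y : Bits N) {q : Fin N} (ha : a ≤ n₁)
    (h : o + n₁ ≤ (q : ℕ)) (h' : (q : ℕ) < o + (n₁ + n₂)) :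
    splitUnary o n₁ n₂ a b y q = decide ((q : ℕ) < o + n₁ + b) := by
  rw [splitUnary, if_pos (by omega), decide_eq_decide]
  omega

/-- The rotated qubits are the last one of the first block and the first zero of the second. Their
neighbours within the blocks serve as controls and pin the two weights down to `{a, a + 1}` and `{b,
b + 1}`; unequal bits at the rotated qubits then leave only the two intended strings. At a block end
the missing neighbour is replaced by the bounds `0 ≤ a' ≤ n₁` and `0 ≤ b' ≤ n₂`. The constant is `46
= 3 * 2 ^ 4 - 2`. -/
theorem exists_gates_transfer {N o n₁ n₂ a b : ℕ} (hN : o + (n₁ + n₂) ≤ N) (ha : a < n₁)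
    (hb : b < n₂) (α : ℝ) :
    ∃ gs : List (Gate N), gs.length ≤ 46 ∧
      (∀ y : Bits N, gatesMatrix gs *ᵥ ket (splitUnary o n₁ n₂ (a + 1) b y) =
        (Real.cos α : ℂ) • ket (splitUnary o n₁ n₂ (a + 1) b y) +
        (Real.sin α : ℂ) • ket (splitUnary o n₁ n₂ a (b + 1) y)) ∧
      (∀ (y : Bits N) (a' b' : ℕ), a' ≤ n₁ → b' ≤ n₂ → ¬ (a' = a + 1 ∧ b' = b) →
        ¬ (a' = a ∧ b' = b + 1) →
        gatesMatrix gs *ᵥ ket (splitUnary o n₁ n₂ a' b' y) =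
          ket (splitUnary o n₁ n₂ a' b' y)) ∧
      ∀ g ∈ gs, ∀ q ∈ g.support,
        (o ≤ (q : ℕ) ∧ (q : ℕ) < o + n₁ ∧ o + a ≤ q + 1 ∧ (q : ℕ) ≤ o + a + 1) ∨
        (o + n₁ ≤ (q : ℕ) ∧ (q : ℕ) < o + (n₁ + n₂) ∧ o + n₁ + b ≤ q + 1 ∧
          (q : ℕ) ≤ o + n₁ + b + 1) := by
  let p : Fin N := ⟨o + a, by omega⟩
  let q : Fin N := ⟨o + n₁ + b, by omega⟩
  have hpq : p ≠ q := by simp only [p, q, ne_eq, Fin.mk.injEq]; omega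
  let cs : Finset (Fin N) := Finset.univ.filter fun r =>
    (o ≤ (r : ℕ) ∧ (r : ℕ) < o + n₁ ∧ ((r : ℕ) + 1 = o + a ∨ (r : ℕ) = o + a + 1)) ∨
    (o + n₁ ≤ (r : ℕ) ∧ (r : ℕ) < o + (n₁ + n₂) ∧
      ((r : ℕ) + 1 = o + n₁ + b ∨ (r : ℕ) = o + n₁ + b + 1))
  have hp : p ∉ cs := by
    simp only [cs, p, Finset.mem_filter, Finset.mem_univ, true_and]; omega
  have hq : q ∉ cs := by
    simp only [cs, q, Finset.mem_filter, Finset.mem_univ, true_and]; omega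
  have hcard : cs.card ≤ 4 := by
    refine le_trans (Finset.card_le_card_of_injOn (t := {o + a - 1, o + a + 1,
      o + n₁ + b - 1, o + n₁ + b + 1}) Fin.val ?_ Fin.val_injective.injOn) Finset.card_le_four
    intro r hr
    simp only [cs, Finset.coe_filter, Finset.mem_univ, true_and, Set.mem_ofPred_eq] at hr
    simp only [Finset.coe_insert, Finset.coe_singleton, Set.mem_insert_iff,
      Set.mem_singleton_iff]
    omega
  -- The strings with weights `(a + 1, b)` and `(a, b + 1)` agree on the controls, so one pattern
  -- serves both.
  let pat : Fin N → Bool := fun r =>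
    decide ((r : ℕ) < o + (a + 1) ∨ (o + n₁ ≤ (r : ℕ) ∧ (r : ℕ) < o + n₁ + b))
  let θ : Bits N → ℝ := fun x => if ∀ r ∈ cs, x r = pat r then α else 0
  have hθ : ∀ x y : Bits N, (∀ i ∈ cs, x i = y i) → θ x = θ y := by
    intro x y h
    have : (∀ r ∈ cs, x r = pat r) ↔ ∀ r ∈ cs, y r = pat r :=
      forall₂_congr fun r hr => by rw [h r hr]
    simp only [θ, this]
  have hs : ∀ x, θ (x ∘ Equiv.swap p q) = θ x := by
    intro x
    refine hθ _ _ fun i hi => ?_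
    rw [Function.comp_apply, Equiv.swap_apply_of_ne_of_ne]
    · rintro rfl; exact hp hi
    · rintro rfl; exact hq hi
  obtain ⟨gs, hgs, hlen, hsupp⟩ := exists_gates_pairRot hpq cs hp hq θ hθ
  refine ⟨gs, ?_, ?_, ?_, ?_⟩
  · have : 2 ^ cs.card ≤ 2 ^ 4 := Nat.pow_le_pow_right (by norm_num) hcard
    omega
  · intro y
    rw [hgs, pairRot_ket hs]
    · have h1 : θ (splitUnary o n₁ n₂ (a + 1) b y) = α := by
        refine if_pos fun r hr => ?_
        simp only [cs, Finset.mem_filter, Finset.mem_univ, true_and] at hr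
        rw [splitUnary, if_pos (by omega)]
      have h2 : splitUnary o n₁ n₂ (a + 1) b y ∘ Equiv.swap p q =
          splitUnary o n₁ n₂ a (b + 1) y := by
        funext r
        by_cases hrp : r = p
        · subst hrp
          rw [Function.comp_apply, Equiv.swap_apply_left,
            splitUnary_right _ (by omega) (by simp [q]) (by simp [q]; omega),
            splitUnary_left _ (by simp [p]) (by simp [p]; omega)]
          simp [p, q]
        · by_cases hrq : r = q
          · subst hrq
            rw [Function.comp_apply, Equiv.swap_apply_right,
              splitUnary_left _ (by simp [p]) (by simp [p]; omega),
              splitUnary_right _ (by omega) (by simp [q]) (by simp [q]; omega)]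
            simp [p, q]
          · rw [Function.comp_apply, Equiv.swap_apply_of_ne_of_ne hrp hrq]
            have h3 : (r : ℕ) ≠ o + a := fun h => hrp (Fin.ext h)
            have h4 : (r : ℕ) ≠ o + n₁ + b := fun h => hrq (Fin.ext h)
            unfold splitUnary
            split_ifs
            · rw [decide_eq_decide]; omega
            · rfl
      rw [h1, h2]
    · rw [splitUnary_left _ (by simp [p]) (by simp [p]; omega)]
      simp [p]
    · rw [splitUnary_right _ (by omega) (by simp [q]) (by simp [q]; omega)]
      simp [q]
  · intro y a' b' ha' hb' h1 h2
    rw [hgs, pairRot_ket_of_eq_zero p q hs]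
    by_contra! hcon
    obtain ⟨hne, h0⟩ := hcon
    rw [splitUnary_left (q := p) _ (by simp [p]) (by simp [p]; omega),
      splitUnary_right (q := q) _ (by omega) (by simp [q]) (by simp [q]; omega), ne_eq,
      decide_eq_decide] at hne
    simp only [p, q] at hne
    have hall : ∀ r ∈ cs, splitUnary o n₁ n₂ a' b' y r = pat r := by
      by_contra h
      exact h0 (if_neg h)
    simp only [cs, Finset.mem_filter, Finset.mem_univ, true_and] at hall
    have hval : ∀ r : ℕ, (o ≤ r ∧ r < o + n₁ ∧ (r + 1 = o + a ∨ r = o + a + 1)) ∨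
        (o + n₁ ≤ r ∧ r < o + (n₁ + n₂) ∧ (r + 1 = o + n₁ + b ∨ r = o + n₁ + b + 1)) →
        ((r < o + a' ∨ (o + n₁ ≤ r ∧ r < o + n₁ + b')) ↔
          (r < o + (a + 1) ∨ (o + n₁ ≤ r ∧ r < o + n₁ + b))) := by
      intro r hr
      have hrN : r < N := by omega
      have := hall ⟨r, hrN⟩ hr
      rw [splitUnary, if_pos (by constructor <;> (simp only; omega)), decide_eq_decide] at this
      exact this
    have e1 : a ≤ a' := by
      by_contra h
      have := hval (o + a - 1) (by omega)
      omega
    have e2 : a' ≤ a + 1 := by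
      by_contra h
      have := hval (o + a + 1) (by omega)
      omega
    have e3 : b ≤ b' := by
      by_contra h
      have := hval (o + n₁ + b - 1) (by omega)
      omega
    have e4 : b' ≤ b + 1 := by
      by_contra h
      have := hval (o + n₁ + b + 1) (by omega)
      omega
    omega
  · intro g hg r hr
    have := hsupp g hg hr
    rw [Finset.mem_insert, Finset.mem_insert] at this
    rcases this with rfl | rfl | h
    · left; simp only [p]; omega
    · right; simp only [q]; omega
    · simp only [cs, Finset.mem_filter, Finset.mem_univ, true_and] at h
      omega

/-! ### Amplitudes of the weight distribution. -/

/-- The number of strings of weight `l` with weight at least `b` on the second block. -/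
def tailCount (n₁ n₂ l b : ℕ) : ℕ :=
  ∑ i ∈ Finset.Ico b (l + 1), n₁.choose (l - i) * n₂.choose i

/-- The amplitude of weight `b` on the second block in the Dicke state of weight `l`. -/
noncomputable def amp (n₁ n₂ l b : ℕ) : ℝ :=
  Real.sqrt ((n₁.choose (l - b) * n₂.choose b : ℕ) / ((n₁ + n₂).choose l : ℝ))

/-- The norm of the part of the Dicke state of weight `l` with weight at least `b` on the second
block. -/
noncomputable def tailAmp (n₁ n₂ l b : ℕ) : ℝ :=
  Real.sqrt (tailCount n₁ n₂ l b / ((n₁ + n₂).choose l : ℝ))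

theorem amp_nonneg (n₁ n₂ l b : ℕ) : 0 ≤ amp n₁ n₂ l b := Real.sqrt_nonneg _

theorem tailAmp_nonneg (n₁ n₂ l b : ℕ) : 0 ≤ tailAmp n₁ n₂ l b := Real.sqrt_nonneg _

theorem tailCount_eq_add {n₁ n₂ l b : ℕ} (h : b ≤ l) :
    tailCount n₁ n₂ l b = n₁.choose (l - b) * n₂.choose b + tailCount n₁ n₂ l (b + 1) :=
  Finset.sum_eq_sum_Ico_succ_bot (by omega) _

theorem tailAmp_zero {n₁ n₂ l : ℕ} (h : l ≤ n₁ + n₂) : tailAmp n₁ n₂ l 0 = 1 := by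
  have h1 : tailCount n₁ n₂ l 0 = (n₁ + n₂).choose l := by
    rw [Nat.add_comm n₁ n₂, Nat.add_choose_eq, Finset.Nat.sum_antidiagonal_eq_sum_range_succ
      (f := fun i j => n₂.choose i * n₁.choose j), tailCount, Finset.range_eq_Ico]
    exact Finset.sum_congr rfl fun i _ => mul_comm _ _
  have h2 : ((n₁ + n₂).choose l : ℝ) ≠ 0 := by
    exact_mod_cast (Nat.choose_pos h).ne'
  rw [tailAmp, h1, div_self h2, Real.sqrt_one]

theorem tailAmp_self (n₁ n₂ l : ℕ) : tailAmp n₁ n₂ l l = amp n₁ n₂ l l := by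
  simp [tailAmp, amp, tailCount]

theorem tailAmp_sq {n₁ n₂ l b : ℕ} (h : b ≤ l) :
    tailAmp n₁ n₂ l b ^ 2 = amp n₁ n₂ l b ^ 2 + tailAmp n₁ n₂ l (b + 1) ^ 2 := by
  simp only [tailAmp, amp]
  rw [Real.sq_sqrt (by positivity), Real.sq_sqrt (by positivity), Real.sq_sqrt (by positivity),
    tailCount_eq_add h]
  push_cast
  ring

/-- Applied with `tailAmp_sq`: the rotation leaves the amplitude `amp` behind and passes the
remaining tail on to the next transfer. -/
theorem exists_angle {r s t : ℝ} (hr : 0 ≤ r) (h : r ^ 2 = s ^ 2 + t ^ 2) :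
    ∃ α : ℝ, r * Real.cos α = s ∧ r * Real.sin α = t := by
  have hn : ‖(⟨s, t⟩ : ℂ)‖ = r := by
    rw [Complex.norm_eq_sqrt_sq_add_sq, ← h, Real.sqrt_sq hr]
  refine ⟨Complex.arg ⟨s, t⟩, ?_, ?_⟩
  · rw [← hn, Complex.norm_mul_cos_arg]
  · rw [← hn, Complex.norm_mul_sin_arg]

/-- The string of weight `l` with weight `b` on the second block, or as close to that as the
size of the first block allows. -/
def distributed {N : ℕ} (o n₁ n₂ l b : ℕ) (y : Bits N) : Bits N :=
  splitUnary o n₁ n₂ (l - max b (l - n₁)) (max b (l - n₁)) y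

theorem distributed_of_le {N o n₁ n₂ l b : ℕ} (h : l ≤ n₁ + b) (y : Bits N) :
    distributed o n₁ n₂ l b y = splitUnary o n₁ n₂ (l - b) b y := by
  rw [distributed, max_eq_left (by omega)]

theorem amp_eq_zero {n₁ n₂ l b : ℕ} (h : n₁ + b < l ∨ n₂ < b) : amp n₁ n₂ l b = 0 := by
  rcases h with h | h
  · rw [amp, Nat.choose_eq_zero_of_lt (show n₁ < l - b by omega)]; simp
  · rw [amp, Nat.choose_eq_zero_of_lt h]; simp

theorem tailAmp_eq_zero {n₁ n₂ l b : ℕ} (h : n₂ < b) : tailAmp n₁ n₂ l b = 0 := by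
  have : tailCount n₁ n₂ l b = 0 := Finset.sum_eq_zero fun i hi => by
    rw [Nat.choose_eq_zero_of_lt (show n₂ < i from h.trans_le (Finset.mem_Ico.1 hi).1), mul_zero]
  simp [tailAmp, this]

/-! ### Rows of transfers and their pipelining. -/

/-- An upper bound, in units of one transfer, for the clocks of the qubits of the two blocks
when the rows `K, …, l + 1` and the first `b` transfers of row `l` have been executed. -/
def waveClock (o n₁ K l b q : ℕ) : ℕ :=
  4 * (K - l) + if q < o + n₁ then max (l - (q - o) - 2) (min b (l - (q - o) + 1))
    else max (min (q - (o + n₁) - 2) K) (min b (q - (o + n₁) + 2))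

/-- The amplitudes of weights below `b` are final, and the whole remaining norm sits on one string,
which the next transfer splits. Strings of other total weight are untouched, so rows for different
`l` do not interfere. -/
theorem exists_gates_row {N o n₁ n₂ K l : ℕ} (hN : o + (n₁ + n₂) ≤ N) (hl : l ≤ n₁ + n₂)
    (b : ℕ) (hb : b ≤ l) :
    ∃ gs : List (Gate N), gs.length ≤ 46 * b ∧
      (∀ y : Bits N, gatesMatrix gs *ᵥ ket (distributed o n₁ n₂ l 0 y) =
        ∑ i ∈ Finset.range b, (amp n₁ n₂ l i : ℂ) • ket (distributed o n₁ n₂ l i y) +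
        (tailAmp n₁ n₂ l b : ℂ) • ket (distributed o n₁ n₂ l b y)) ∧
      (∀ (y : Bits N) (a' b' : ℕ), a' ≤ n₁ → b' ≤ n₂ → a' + b' ≠ l →
        gatesMatrix gs *ᵥ ket (splitUnary o n₁ n₂ a' b' y) =
          ket (splitUnary o n₁ n₂ a' b' y)) ∧
      ∀ (t : ℕ) (c : Fin N → ℕ), (∀ q : Fin N, o ≤ (q : ℕ) ∧ (q : ℕ) < o + (n₁ + n₂) →
        c q ≤ t + 46 * waveClock o n₁ K l 0 q) → ∀ q : Fin N,
          clock gs c q ≤ if o ≤ (q : ℕ) ∧ (q : ℕ) < o + (n₁ + n₂) then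
            t + 46 * waveClock o n₁ K l b q else c q := by
  induction b with
  | zero =>
    refine ⟨[], by simp, ?_, ?_, ?_⟩
    · intro y
      simp [gatesMatrix, tailAmp_zero hl]
    · intro y a' b' _ _ _
      simp [gatesMatrix]
    · intro t c hc q
      split_ifs with h
      · exact hc q h
      · exact le_rfl
  | succ b ih =>
    obtain ⟨gs, hlen, hrow, hfix, hclk⟩ := ih (by omega)
    have hmono : ∀ q, waveClock o n₁ K l b q ≤ waveClock o n₁ K l (b + 1) q := by
      intro q
      unfold waveClock
      split_ifs <;> omega
    by_cases hex : l ≤ n₁ + b ∧ b < n₂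
    · obtain ⟨hb1, hb2⟩ := hex
      obtain ⟨α, hcos, hsin⟩ := exists_angle (tailAmp_nonneg n₁ n₂ l b)
        (tailAmp_sq (n₁ := n₁) (n₂ := n₂) (show b ≤ l by omega))
      obtain ⟨a, ha⟩ : ∃ a, l = a + 1 + b := ⟨l - b - 1, by omega⟩
      obtain ⟨hs, hslen, hstep, hsfix, hsupp⟩ :=
        exists_gates_transfer (o := o) hN (show a < n₁ by omega) hb2 α
      refine ⟨gs ++ hs, ?_, ?_, ?_, ?_⟩
      · rw [List.length_append]; omega
      · intro y
        rw [gatesMatrix_append, ← Matrix.mulVec_mulVec, hrow, Matrix.mulVec_add,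
          Matrix.mulVec_sum, Matrix.mulVec_smul, Finset.sum_range_succ, add_assoc]
        congr 1
        · refine Finset.sum_congr rfl fun i hi => ?_
          rw [Finset.mem_range] at hi
          rw [Matrix.mulVec_smul]
          by_cases h : n₁ + i < l
          · simp [amp_eq_zero (n₂ := n₂) (Or.inl h)]
          · rw [distributed_of_le (by omega), hsfix _ _ _ (by omega) (by omega) (by omega)
              (by omega)]
        · rw [distributed_of_le hb1, distributed_of_le (by omega),
            show l - b = a + 1 by omega, show l - (b + 1) = a by omega, hstep, smul_add,
            smul_smul, smul_smul, ← Complex.ofReal_mul, ← Complex.ofReal_mul, hcos, hsin]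
      · intro y a' b' ha' hb' hne
        rw [gatesMatrix_append, ← Matrix.mulVec_mulVec, hfix y a' b' ha' hb' hne,
          hsfix y a' b' ha' hb' (by omega) (by omega)]
      · intro t c hc q
        rw [clock_append]
        let S : Finset (Fin N) := Finset.univ.filter fun q : Fin N =>
          (o ≤ (q : ℕ) ∧ (q : ℕ) < o + n₁ ∧ o + a ≤ q + 1 ∧ (q : ℕ) ≤ o + a + 1) ∨
          (o + n₁ ≤ (q : ℕ) ∧ (q : ℕ) < o + (n₁ + n₂) ∧ o + n₁ + b ≤ q + 1 ∧
            (q : ℕ) ≤ o + n₁ + b + 1)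
        have hmem : ∀ q, q ∈ S ↔
            (o ≤ (q : ℕ) ∧ (q : ℕ) < o + n₁ ∧ o + a ≤ q + 1 ∧ (q : ℕ) ≤ o + a + 1) ∨
            (o + n₁ ≤ (q : ℕ) ∧ (q : ℕ) < o + (n₁ + n₂) ∧ o + n₁ + b ≤ q + 1 ∧
              (q : ℕ) ≤ o + n₁ + b + 1) := fun q => by simp [S]
        have hS : ∀ g ∈ hs, g.support ⊆ S := fun g hg r hr => (hmem r).2 (hsupp g hg r hr)
        by_cases hq : q ∈ S
        -- The wave has just arrived: every qubit touched by this transfer has its clock within `4 *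
        -- (K - l) + b` units, and the transfer takes one unit of 46.
        · have h1 := clock_le_add_length hS (c := clock gs c)
            (t := t + 46 * (4 * (K - l) + b)) (fun r hr => by
              have h2 := hclk t c hc r
              have hr' := (hmem r).1 hr
              rw [if_pos (by omega)] at h2
              refine h2.trans ?_
              have : waveClock o n₁ K l b r ≤ 4 * (K - l) + b := by
                unfold waveClock
                split_ifs <;> omega
              omega) hq
          have hq' := (hmem q).1 hq
          have : 4 * (K - l) + b + 1 ≤ waveClock o n₁ K l (b + 1) q := by
            unfold waveClock
            split_ifs <;> omega
          rw [if_pos (by omega)]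
          omega
        · rw [clock_of_notMem hS _ hq]
          refine (hclk t c hc q).trans ?_
          have := hmono q
          split_ifs <;> omega
    -- Impossible transfers are skipped. If `l > n₁ + b`, the amplitude vanishes and the truncation
    -- in `distributed` makes the strings for `b` and `b + 1` equal; if `b ≥ n₂`, the tail beyond
    -- `b` vanishes.
    · refine ⟨gs, by omega, ?_, hfix, ?_⟩
      · intro y
        rw [hrow, Finset.sum_range_succ, add_assoc]
        congr 1
        by_cases h1 : l ≤ n₁ + b
        · have h2 : tailAmp n₁ n₂ l (b + 1) = 0 := tailAmp_eq_zero (by omega)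
          have h3 : tailAmp n₁ n₂ l b = amp n₁ n₂ l b := by
            have h4 := tailAmp_sq (n₁ := n₁) (n₂ := n₂) (show b ≤ l by omega)
            rw [h2] at h4
            exact (sq_eq_sq₀ (tailAmp_nonneg _ _ _ _) (amp_nonneg _ _ _ _)).1 (by simpa using h4)
          simp [h2, h3]
        · have h2 : amp n₁ n₂ l b = 0 := amp_eq_zero (by omega)
          have h3 : tailAmp n₁ n₂ l b = tailAmp n₁ n₂ l (b + 1) := by
            have h4 := tailAmp_sq (n₁ := n₁) (n₂ := n₂) (show b ≤ l by omega)
            rw [h2] at h4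
            exact (sq_eq_sq₀ (tailAmp_nonneg _ _ _ _) (tailAmp_nonneg _ _ _ _)).1 (by simpa using h4)
          have h5 : distributed o n₁ n₂ l b y = distributed o n₁ n₂ l (b + 1) y := by
            unfold distributed
            rw [show max b (l - n₁) = max (b + 1) (l - n₁) by omega]
          rw [h2, h3, h5]
          simp
      · intro t c hc q
        refine (hclk t c hc q).trans ?_
        have := hmono q
        split_ifs <;> omega

theorem exists_gates_rows {N o n₁ n₂ K : ℕ} (hN : o + (n₁ + n₂) ≤ N) (hK : K ≤ n₁ + n₂)
    (r : ℕ) (hr : r ≤ K) :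
    ∃ gs : List (Gate N), gs.length ≤ 46 * (K * r) ∧
      (∀ l ≤ K, K < l + r → ∀ y : Bits N, gatesMatrix gs *ᵥ ket (distributed o n₁ n₂ l 0 y) =
        ∑ i ∈ Finset.range (l + 1), (amp n₁ n₂ l i : ℂ) • ket (distributed o n₁ n₂ l i y)) ∧
      (∀ (y : Bits N) (a' b' : ℕ), a' ≤ n₁ → b' ≤ n₂ → a' + b' + r ≤ K →
        gatesMatrix gs *ᵥ ket (splitUnary o n₁ n₂ a' b' y) =
          ket (splitUnary o n₁ n₂ a' b' y)) ∧
      ∀ (t : ℕ) (c : Fin N → ℕ), (∀ q : Fin N, o ≤ (q : ℕ) ∧ (q : ℕ) < o + (n₁ + n₂) →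
        c q ≤ t) → ∀ q : Fin N,
          clock gs c q ≤ if o ≤ (q : ℕ) ∧ (q : ℕ) < o + (n₁ + n₂) then
            t + 46 * waveClock o n₁ K (K - r) 0 q else c q := by
  induction r with
  | zero =>
    refine ⟨[], by simp, ?_, ?_, ?_⟩
    · intro l h1 h2
      omega
    · intro y a' b' _ _ _
      simp [gatesMatrix]
    · intro t c hc q
      split_ifs with h
      · exact (hc q h).trans (Nat.le_add_right _ _)
      · exact le_rfl
  | succ r ih =>
    obtain ⟨gs, hlen, hrow, hfix, hclk⟩ := ih (by omega)
    obtain ⟨hs, hslen, hsrow, hsfix, hsclk⟩ := exists_gates_row (K := K) hN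
      (show K - r ≤ n₁ + n₂ by omega) (K - r) le_rfl
    refine ⟨gs ++ hs, ?_, ?_, ?_, ?_⟩
    · rw [List.length_append, Nat.mul_succ]; omega
    · intro l hl1 hl2 y
      rw [gatesMatrix_append, ← Matrix.mulVec_mulVec]
      by_cases h : l = K - r
      · have h1 : gatesMatrix gs *ᵥ ket (distributed o n₁ n₂ l 0 y) =
            ket (distributed o n₁ n₂ l 0 y) :=
          hfix y _ _ (by omega) (by omega) (by omega)
        rw [h1, h, hsrow, tailAmp_self, Finset.sum_range_succ]
      · rw [hrow l hl1 (by omega), Matrix.mulVec_sum]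
        refine Finset.sum_congr rfl fun i hi => ?_
        rw [Finset.mem_range] at hi
        rw [Matrix.mulVec_smul]
        by_cases h1 : n₁ + i < l ∨ n₂ < i
        · simp [amp_eq_zero h1]
        · rw [distributed_of_le (by omega), hsfix _ _ _ (by omega) (by omega) (by omega)]
    · intro y a' b' ha' hb' hab
      rw [gatesMatrix_append, ← Matrix.mulVec_mulVec, hfix y a' b' ha' hb' (by omega),
        hsfix y a' b' ha' hb' (by omega)]
    · intro t c hc q
      rw [clock_append]
      have h1 := hsclk t (clock gs c) (fun q hq => by
        have := hclk t c hc q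
        rwa [if_pos hq] at this) q
      refine h1.trans ?_
      -- This is where a delay of four is needed. At depth `j` in the first block, away from
      -- truncation, row `l` finishes at `l - j + 1`, and row `l - 1` expects the qubit at `4 + (l -
      -- 1 - j - 2)`, the same number.
      have h2 : waveClock o n₁ K (K - r) (K - r) q ≤ waveClock o n₁ K (K - (r + 1)) 0 q := by
        unfold waveClock
        split_ifs <;> omega
      split_ifs with hq
      · omega
      · have := hclk t c hc q
        rwa [if_neg hq] at this

theorem exists_gates_weightDistribution {N o n₁ n₂ K : ℕ} (hN : o + (n₁ + n₂) ≤ N)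
    (hK : K ≤ n₁ + n₂) :
    ∃ gs : List (Gate N), gs.length ≤ 46 * (K * K) ∧
      (∀ l ≤ K, ∀ y : Bits N, gatesMatrix gs *ᵥ ket (splitUnary o (n₁ + n₂) 0 l 0 y) =
        ∑ i ∈ Finset.range (l + 1), (amp n₁ n₂ l i : ℂ) • ket (distributed o n₁ n₂ l i y)) ∧
      ∀ (t : ℕ) (c : Fin N → ℕ), (∀ q : Fin N, o ≤ (q : ℕ) ∧ (q : ℕ) < o + (n₁ + n₂) →
        c q ≤ t) → ∀ q : Fin N,
          clock gs c q ≤ if o ≤ (q : ℕ) ∧ (q : ℕ) < o + (n₁ + n₂) then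
            t + 230 * K else c q := by
  obtain ⟨gs, hlen, hrow, hfix, hclk⟩ := exists_gates_rows hN hK K le_rfl
  refine ⟨gs, hlen, ?_, ?_⟩
  · intro l hl y
    have h0 : splitUnary o (n₁ + n₂) 0 l 0 y = distributed o n₁ n₂ l 0 y := by
      funext q
      unfold distributed splitUnary
      rw [Nat.add_zero]
      split_ifs
      · rw [decide_eq_decide]; omega
      · rfl
    rw [h0]
    -- Weight zero has no row of its own; its string is fixed by all rows.
    rcases Nat.eq_zero_or_pos l with rfl | hpos
    · rw [show distributed o n₁ n₂ 0 0 y = splitUnary o n₁ n₂ 0 0 y from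
        distributed_of_le (Nat.zero_le _) y, hfix y 0 0 (by omega) (by omega) (by omega)]
      simp [amp, distributed_of_le (Nat.zero_le _)]
    · exact hrow l hl (by omega) y
  · intro t c hc q
    refine (hclk t c hc q).trans ?_
    -- Delays contribute `4 * K` and the last sweep at most `K`, whence `230 = 46 * 5`.
    have : waveClock o n₁ K (K - K) 0 q ≤ 5 * K := by
      unfold waveClock
      split_ifs <;> omega
    split_ifs <;> omega

/-! ### Dicke states on a block of qubits -/

/-- The number of ones of `x` in the block `[o, o + n)`. -/
def blockWeight {N : ℕ} (o n : ℕ) (x : Bits N) : ℕ :=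
  (Finset.univ.filter fun q : Fin N =>
    (o ≤ (q : ℕ) ∧ (q : ℕ) < o + n) ∧ x q = true).card

/-- The Dicke state of weight `l` on the block `[o, o + n)`, tensored with the basis state given
by `y` on all other qubits. -/
noncomputable def blockDicke {N : ℕ} (o n l : ℕ) (y : Bits N) : QState N := fun z =>
  if (∀ q : Fin N, ¬ (o ≤ (q : ℕ) ∧ (q : ℕ) < o + n) → z q = y q) ∧ blockWeight o n z = l then
    (((Real.sqrt (n.choose l : ℝ))⁻¹ : ℝ) : ℂ) else 0

/-- A Dicke state unitary on the block `[o, o + n)` of an `N`-qubit register is realised by at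
most `F` gates of that block, in depth at most `D`. -/
def Realizable (N o n k F D : ℕ) : Prop :=
  ∃ gs : List (Gate N), gs.length ≤ F ∧
    (∀ l ≤ k, l ≤ n → ∀ y : Bits N,
      gatesMatrix gs *ᵥ ket (splitUnary o n 0 l 0 y) = blockDicke o n l y) ∧
    ∀ (t : ℕ) (c : Fin N → ℕ), (∀ q : Fin N, o ≤ (q : ℕ) ∧ (q : ℕ) < o + n → c q ≤ t) →
      ∀ q : Fin N, clock gs c q ≤ if o ≤ (q : ℕ) ∧ (q : ℕ) < o + n then t + D else c q

theorem Realizable.mono {N o n k F D F' D' : ℕ} (h : Realizable N o n k F D) (hF : F ≤ F')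
    (hD : D ≤ D') : Realizable N o n k F' D' := by
  obtain ⟨gs, h1, h2, h3⟩ := h
  refine ⟨gs, h1.trans hF, h2, fun t c hc q => (h3 t c hc q).trans ?_⟩
  split_ifs <;> omega

theorem blockWeight_add {N : ℕ} (o n₁ n₂ : ℕ) (x : Bits N) :
    blockWeight o (n₁ + n₂) x = blockWeight o n₁ x + blockWeight (o + n₁) n₂ x := by
  unfold blockWeight
  rw [← Finset.card_union_of_disjoint]
  · congr 1
    ext q
    simp only [Finset.mem_filter, Finset.mem_univ, true_and, Finset.mem_union, ← or_and_right]
    refine and_congr_left fun _ => ?_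
    omega
  · rw [Finset.disjoint_left]
    intro q hq hq'
    simp only [Finset.mem_filter, Finset.mem_univ, true_and] at hq hq'
    omega

theorem blockWeight_le {N : ℕ} (o n : ℕ) (x : Bits N) : blockWeight o n x ≤ n := by
  have h : (Finset.Ico o (o + n)).card = n := by simp
  refine le_of_le_of_eq
    (Finset.card_le_card_of_injOn Fin.val ?_ Fin.val_injective.injOn) h
  intro q hq
  simp only [Finset.coe_filter, Finset.mem_univ, true_and, Set.mem_ofPred_eq] at hq
  simp [hq.1]

theorem blockWeight_congr {N o n : ℕ} {x y : Bits N}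
    (h : ∀ q : Fin N, o ≤ (q : ℕ) → (q : ℕ) < o + n → x q = y q) :
    blockWeight o n x = blockWeight o n y := by
  unfold blockWeight
  congr 1
  ext q
  simp only [Finset.mem_filter, Finset.mem_univ, true_and]
  exact and_congr_right fun hq => by rw [h q hq.1 hq.2]

theorem mulVec_eq_sum_ket {N : ℕ} (M : Matrix (Bits N) (Bits N) ℂ) (ψ : QState N)
    (z : Bits N) : (M *ᵥ ψ) z = ∑ w, ψ w * (M *ᵥ ket w) z := by
  have h : ψ = ∑ w, ψ w • ket w := by
    funext x
    simp [ket, Pi.single_apply, Finset.sum_apply]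
  conv_lhs => rw [h, Matrix.mulVec_sum]
  simp [Finset.sum_apply, Matrix.mulVec_smul]

/-- Replaces a tensor product argument. For a given output `z`, the only contributing input is `w₀`,
which copies `z` on the first block and the unary string elsewhere. Having `hM` for every `y` covers
all contents of the first block. -/
theorem mulVec_blockDicke {N o n₁ n₂ a b : ℕ} {M : Matrix (Bits N) (Bits N) ℂ}
    (hM : ∀ y : Bits N, M *ᵥ ket (splitUnary (o + n₁) n₂ 0 b 0 y) = blockDicke (o + n₁) n₂ b y)
    (ha : a ≤ n₁) (y z : Bits N) :
    (M *ᵥ blockDicke o n₁ a (splitUnary o n₁ n₂ a b y)) z =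
      if (∀ q : Fin N, ¬ (o ≤ (q : ℕ) ∧ (q : ℕ) < o + (n₁ + n₂)) → z q = y q) ∧
        blockWeight o n₁ z = a ∧ blockWeight (o + n₁) n₂ z = b then
        (((Real.sqrt (n₁.choose a : ℝ))⁻¹ * (Real.sqrt (n₂.choose b : ℝ))⁻¹ : ℝ) : ℂ)
      else 0 := by
  set y' := splitUnary o n₁ n₂ a b y with hy'
  let w₀ : Bits N := fun q => if o ≤ (q : ℕ) ∧ (q : ℕ) < o + n₁ then z q else y' q
  have hket : ∀ w : Bits N, (∀ q : Fin N, ¬ (o ≤ (q : ℕ) ∧ (q : ℕ) < o + n₁) → w q = y' q) →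
      M *ᵥ ket w = blockDicke (o + n₁) n₂ b w := by
    intro w hw
    rw [← hM w]
    congr 2
    funext q
    unfold splitUnary
    split_ifs with h
    · rw [hw q (by omega), hy', splitUnary_right _ ha (by omega) (by omega), decide_eq_decide]
      omega
    · rfl
  have hw₀ : ∀ q : Fin N, ¬ (o ≤ (q : ℕ) ∧ (q : ℕ) < o + n₁) → w₀ q = y' q :=
    fun q hq => if_neg hq
  have hwt : blockWeight o n₁ w₀ = blockWeight o n₁ z :=
    blockWeight_congr fun q h h' => if_pos ⟨h, h'⟩
  have hoff : (∀ q : Fin N, ¬ (o + n₁ ≤ (q : ℕ) ∧ (q : ℕ) < o + n₁ + n₂) → z q = w₀ q) ↔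
      ∀ q : Fin N, ¬ (o ≤ (q : ℕ) ∧ (q : ℕ) < o + (n₁ + n₂)) → z q = y q := by
    refine forall_congr' fun q => ⟨fun h hq => ?_, fun h hq => ?_⟩
    · rw [h (by omega), hw₀ q (by omega), hy', splitUnary, if_neg hq]
    · by_cases hA : o ≤ (q : ℕ) ∧ (q : ℕ) < o + n₁
      · exact (if_pos hA).symm
      · rw [hw₀ q hA, hy', splitUnary, if_neg (by omega), h (by omega)]
  rw [mulVec_eq_sum_ket, Finset.sum_eq_single w₀]
  · rw [hket w₀ hw₀]
    unfold blockDicke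
    simp only [hwt, hoff]
    by_cases h1 : blockWeight o n₁ z = a
    · by_cases h2 : (∀ q : Fin N, ¬ (o ≤ (q : ℕ) ∧ (q : ℕ) < o + (n₁ + n₂)) → z q = y q) ∧
          blockWeight (o + n₁) n₂ z = b
      · rw [if_pos ⟨hw₀, h1⟩, if_pos h2, if_pos ⟨h2.1, h1, h2.2⟩, Complex.ofReal_mul]
      · rw [if_neg h2, mul_zero, if_neg fun h => h2 ⟨h.1, h.2.2⟩]
    · rw [if_neg fun h => h1 h.2, zero_mul, if_neg fun h => h1 h.2.1]
  · intro w _ hne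
    by_contra h
    obtain ⟨h1, h2⟩ := mul_ne_zero_iff.1 h
    have hw : ∀ q : Fin N, ¬ (o ≤ (q : ℕ) ∧ (q : ℕ) < o + n₁) → w q = y' q := by
      by_contra h3
      exact h1 (if_neg fun h4 => h3 h4.1)
    rw [hket w hw] at h2
    have hz : ∀ q : Fin N, ¬ (o + n₁ ≤ (q : ℕ) ∧ (q : ℕ) < o + n₁ + n₂) → z q = w q := by
      by_contra h3
      exact h2 (if_neg fun h4 => h3 h4.1)
    refine hne (funext fun q => ?_)
    by_cases hA : o ≤ (q : ℕ) ∧ (q : ℕ) < o + n₁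
    · rw [← hz q (by omega)]
      exact (if_pos hA).symm
    · rw [hw q hA, hw₀ q hA]
  · simp

theorem amp_mul_inv {n₁ n₂ l b : ℕ} (h₁ : l - b ≤ n₁) (h₂ : b ≤ n₂) :
    amp n₁ n₂ l b * ((Real.sqrt (n₁.choose (l - b) : ℝ))⁻¹ * (Real.sqrt (n₂.choose b : ℝ))⁻¹) =
      (Real.sqrt ((n₁ + n₂).choose l : ℝ))⁻¹ := by
  have h3 : (0 : ℝ) < n₁.choose (l - b) := by exact_mod_cast Nat.choose_pos h₁
  have h4 : (0 : ℝ) < n₂.choose b := by exact_mod_cast Nat.choose_pos h₂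
  rw [amp, Nat.cast_mul, Real.sqrt_div (by positivity), Real.sqrt_mul h3.le]
  have h5 := (Real.sqrt_pos.2 h3).ne'
  have h6 := (Real.sqrt_pos.2 h4).ne'
  field_simp

/-- At an output `z` only the summand with `i` equal to the weight of `z` on the second block
survives, and `amp_mul_inv` turns its coefficient into the uniform one. The depths of the parts
enter as a maximum because each circuit leaves the clocks outside its own block unchanged. -/
theorem Realizable.combine {N o n₁ n₂ k F₁ F₂ D₁ D₂ : ℕ} (hN : o + (n₁ + n₂) ≤ N)
    (h₁ : Realizable N o n₁ k F₁ D₁) (h₂ : Realizable N (o + n₁) n₂ k F₂ D₂) :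
    Realizable N o (n₁ + n₂) k
      (46 * (min k (n₁ + n₂) * min k (n₁ + n₂)) + F₁ + F₂)
      (230 * min k (n₁ + n₂) + max D₁ D₂) := by
  obtain ⟨gs, hlen, hrow, hclk⟩ := exists_gates_weightDistribution hN (Nat.min_le_right k _)
  obtain ⟨gs₁, hlen₁, hM₁, hclk₁⟩ := h₁
  obtain ⟨gs₂, hlen₂, hM₂, hclk₂⟩ := h₂
  refine ⟨gs ++ (gs₁ ++ gs₂), ?_, ?_, ?_⟩
  · simp only [List.length_append]; omega
  · intro l hlk hln y
    rw [gatesMatrix_append, gatesMatrix_append, ← Matrix.mulVec_mulVec,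
      hrow l (le_min hlk hln), Matrix.mulVec_sum]
    funext z
    have hterm : ∀ i ∈ Finset.range (l + 1),
        ((gatesMatrix gs₂ * gatesMatrix gs₁) *ᵥ
          ((amp n₁ n₂ l i : ℂ) • ket (distributed o n₁ n₂ l i y))) z =
        if ((∀ q : Fin N, ¬ (o ≤ (q : ℕ) ∧ (q : ℕ) < o + (n₁ + n₂)) → z q = y q) ∧
            blockWeight o (n₁ + n₂) z = l) ∧ i = blockWeight (o + n₁) n₂ z then
          (((Real.sqrt ((n₁ + n₂).choose l : ℝ))⁻¹ : ℝ) : ℂ) else 0 := by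
      intro i hi
      rw [Finset.mem_range] at hi
      have hw := blockWeight_add o n₁ n₂ z
      have hw₁ := blockWeight_le o n₁ z
      have hw₂ := blockWeight_le (o + n₁) n₂ z
      by_cases hv : n₁ + i < l ∨ n₂ < i
      · rw [if_neg (by rintro ⟨⟨-, h⟩, h'⟩; omega), amp_eq_zero hv]
        simp
      · have hsplit : splitUnary o n₁ n₂ (l - i) i y =
            splitUnary o n₁ 0 (l - i) 0 (splitUnary o n₁ n₂ (l - i) i y) := by
          funext q
          conv_rhs => unfold splitUnary
          split_ifs with h h'
          · rw [splitUnary_left _ (by omega) (by omega), decide_eq_decide]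
            omega
          · rw [splitUnary, if_pos h']
          · rw [splitUnary, if_neg h']
        rw [Matrix.mulVec_smul, Pi.smul_apply, smul_eq_mul, distributed_of_le (by omega),
          ← Matrix.mulVec_mulVec, hsplit, hM₁ _ (by omega) (by omega),
          mulVec_blockDicke (fun y => hM₂ i (by omega) (by omega) y) (by omega)]
        by_cases h : (∀ q : Fin N, ¬ (o ≤ (q : ℕ) ∧ (q : ℕ) < o + (n₁ + n₂)) → z q = y q) ∧
            blockWeight o n₁ z = l - i ∧ blockWeight (o + n₁) n₂ z = i
        · rw [if_pos h, if_pos ⟨⟨h.1, by omega⟩, h.2.2.symm⟩, ← Complex.ofReal_mul,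
            amp_mul_inv (by omega) (by omega)]
        · rw [if_neg h, if_neg fun h' => h ⟨h'.1.1, by omega, h'.2.symm⟩, mul_zero]
    rw [Finset.sum_apply, Finset.sum_congr rfl hterm, blockDicke]
    by_cases h : (∀ q : Fin N, ¬ (o ≤ (q : ℕ) ∧ (q : ℕ) < o + (n₁ + n₂)) → z q = y q) ∧
        blockWeight o (n₁ + n₂) z = l
    · have hw := blockWeight_add o n₁ n₂ z
      rw [if_pos h]
      simp only [h.2, and_true]
      rw [Finset.sum_eq_single (blockWeight (o + n₁) n₂ z)]
      · rw [if_pos ⟨h.1, rfl⟩]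
      · intro i _ hne
        exact if_neg fun h' => hne h'.2
      · intro hi
        rw [Finset.mem_range] at hi
        omega
    · rw [if_neg h]
      exact Finset.sum_eq_zero fun i _ => if_neg fun h' => h h'.1
  · intro t c hc q
    rw [clock_append, clock_append]
    set K := min k (n₁ + n₂)
    have e := hclk t c hc
    have e₁ := hclk₁ (t + 230 * K) (clock gs c) (fun r hr => by
      have := e r
      rwa [if_pos (by omega)] at this)
    have e₂ := hclk₂ (t + 230 * K) (clock gs₁ (clock gs c)) (fun r hr => by
      have h1 := e r
      have h2 := e₁ r
      rw [if_pos (by omega)] at h1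
      rw [if_neg (by omega)] at h2
      omega)
    have f := e q
    have f₁ := e₁ q
    have f₂ := e₂ q
    split_ifs at f f₁ f₂ ⊢ <;> omega

theorem realizable_one {N o : ℕ} (hN : o < N) (k : ℕ) : Realizable N o 1 k 0 0 := by
  refine ⟨[], by simp, ?_, ?_⟩
  · intro l _ hl y
    rw [gatesMatrix, Matrix.one_mulVec]
    funext z
    have hw : blockWeight o 1 z = if z ⟨o, hN⟩ then 1 else 0 := by
      unfold blockWeight
      split_ifs with h
      · rw [Finset.card_eq_one]
        refine ⟨⟨o, hN⟩, ?_⟩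
        ext q
        simp only [Finset.mem_filter, Finset.mem_univ, true_and, Finset.mem_singleton]
        constructor
        · rintro ⟨h1, -⟩
          exact Fin.ext (by simp only; omega)
        · rintro rfl
          exact ⟨by simp, h⟩
      · rw [Finset.card_eq_zero, Finset.filter_eq_empty_iff]
        rintro q - ⟨h1, h2⟩
        exact h (by rwa [show q = ⟨o, hN⟩ from Fin.ext (by simp only; omega)] at h2)
    have hiff : z = splitUnary o 1 0 l 0 y ↔
        (∀ q : Fin N, ¬ (o ≤ (q : ℕ) ∧ (q : ℕ) < o + 1) → z q = y q) ∧
          blockWeight o 1 z = l := by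
      rw [hw]
      constructor
      · rintro rfl
        refine ⟨fun q hq => if_neg hq, ?_⟩
        rw [splitUnary_left _ (by simp) (by simp)]
        interval_cases l <;> simp
      · rintro ⟨h1, h2⟩
        funext q
        by_cases hq : o ≤ (q : ℕ) ∧ (q : ℕ) < o + 1
        · obtain rfl : q = ⟨o, hN⟩ := Fin.ext (by simp only; omega)
          rw [splitUnary_left _ (by simp) (by simp)]
          subst h2
          cases z ⟨o, hN⟩ <;> simp
        · rw [h1 q hq, splitUnary, if_neg hq]
    have hc : Nat.choose 1 l = 1 := by interval_cases l <;> rfl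
    rw [ket, Pi.single_apply, blockDicke, hc]
    simp only [hiff]
    simp
  · intro t c hc q
    split_ifs with h
    · exact hc q h
    · exact le_rfl

/-! ### The halving recursion and its cost. -/

/-- Halving down to single qubits. The depth bound needs `230 n + 690 ⌈n/2⌉ ≤ 690 n`, which is sharp
at `n = 3`; the gate constant `138 = 3 * 46` likewise leaves room for unequal halves. -/
theorem realizable_of_le {N k : ℕ} (n : ℕ) : ∀ o, 1 ≤ n → n ≤ k → o + n ≤ N →
    Realizable N o n k (138 * (n * n)) (690 * n) := by
  induction n using Nat.strong_induction_on with
  | _ n ih =>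
    intro o hn hk hN
    rcases Nat.lt_or_ge 1 n with h | h
    · have h₁ := ih (n / 2) (by omega) o (by omega) (by omega) (by omega)
      have h₂ := ih (n - n / 2) (by omega) (o + n / 2) (by omega) (by omega) (by omega)
      have h₃ := Realizable.combine (by omega) h₁ h₂
      rw [show n / 2 + (n - n / 2) = n by omega, min_eq_right hk] at h₃
      refine h₃.mono ?_ (by omega)
      have hm : n = 2 * (n / 2) ∨ n = 2 * (n / 2) + 1 := by omega
      have hm1 : 1 ≤ n / 2 := by omega
      generalize n / 2 = m at hm hm1
      rcases hm with rfl | rfl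
      · rw [show 2 * m - m = m by omega]
        nlinarith
      · rw [show 2 * m + 1 - m = m + 1 by omega]
        nlinarith
    · obtain rfl : n = 1 := by omega
      exact (realizable_one (by omega) k).mono (by omega) (by omega)

/-- The surplus `46 * (k * k)` strengthens the induction: two halves bring two surpluses, one paying
for the distribution and one remaining. The condition `k ≤ 2 * n` keeps the surplus affordable in
blocks of size at most `k`, and it survives halving when `n > k`. -/
theorem realizable_of_le_mul_two_pow {N k : ℕ} (m : ℕ) : ∀ n o, 1 ≤ n → n ≤ k * 2 ^ m →
    k ≤ 2 * n → o + n ≤ N →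
    ∃ F, F + 46 * (k * k) ≤ 184 * (k * n) ∧ Realizable N o n k F (230 * (k * (3 + m))) := by
  have small : ∀ m n o, 1 ≤ n → n ≤ k → k ≤ 2 * n → o + n ≤ N →
      ∃ F, F + 46 * (k * k) ≤ 184 * (k * n) ∧
        Realizable N o n k F (230 * (k * (3 + m))) := by
    intro m n o hn hk hk2 hN
    refine ⟨138 * (n * n), ?_, (realizable_of_le n o hn hk hN).mono le_rfl ?_⟩
    · obtain ⟨d, rfl⟩ := Nat.exists_eq_add_of_le hk
      nlinarith [Nat.mul_le_mul_left d hk2]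
    · nlinarith [Nat.zero_le (k * m)]
  induction m with
  | zero =>
    intro n o hn hk hk2 hN
    exact small 0 n o hn (by simpa using hk) hk2 hN
  | succ m ih =>
    intro n o hn hk hk2 hN
    rcases Nat.lt_or_ge k n with h | h
    · rw [pow_succ, ← mul_assoc] at hk
      rcases Nat.lt_or_ge 1 n with h1 | h1
      · obtain ⟨F₁, hF₁, h₁⟩ := ih (n / 2) o (by omega) (by omega) (by omega) (by omega)
        obtain ⟨F₂, hF₂, h₂⟩ := ih (n - n / 2) (o + n / 2) (by omega) (by omega) (by omega)
          (by omega)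
        have h₃ := Realizable.combine (by omega) h₁ h₂
        rw [show n / 2 + (n - n / 2) = n by omega, min_eq_left h.le, max_self] at h₃
        refine ⟨_, ?_, h₃.mono le_rfl ?_⟩
        · have : k * n = k * (n / 2) + k * (n - n / 2) := by
            rw [← mul_add]; congr 1; omega
          omega
        · rw [← mul_add]
          exact Nat.mul_le_mul_left _ (by nlinarith)
      · obtain ⟨rfl, rfl⟩ : k = 0 ∧ n = 1 := by omega
        simp at hk
    · exact small (m + 1) n o hn h hk2 hN

theorem blockDicke_zero_eq_dicke (n l : ℕ) (y : Bits n) : blockDicke 0 n l y = dicke n l := by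
  funext z
  have hw : blockWeight 0 n z = hammingWeight z := by
    unfold blockWeight hammingWeight
    congr 1
    ext q
    simp
  rw [blockDicke, hw, dicke, Pi.smul_apply, Finset.sum_apply]
  simp [ket, Pi.single_apply]

theorem Realizable.exists_circuit {n k F D : ℕ} (hkn : k ≤ n) (h : Realizable n 0 n k F D) :
    ∃ c : Circuit n, IsDickeStateUnitary n k c.toMatrix ∧ c.gateCount ≤ F ∧ c.depth = D := by
  obtain ⟨gs, hlen, hM, hclk⟩ := h
  obtain ⟨c, hmat, hcount, hdepth⟩ := DickeCircuit.exists_circuit (D := D) gs (fun q => by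
    have := hclk 0 0 (fun _ _ => le_rfl) q
    rwa [if_pos (by omega), zero_add] at this)
  refine ⟨c, ⟨hmat ▸ gatesMatrix_mem_unitaryGroup gs, fun l hl => ?_⟩, hcount ▸ hlen, hdepth⟩
  have hu : unary n l = splitUnary 0 n 0 l 0 (unary n l) := by
    funext q
    rw [splitUnary_left _ (by omega) (by omega), unary]
    simp
  rw [hmat, hu, hM l hl (hl.trans hkn), blockDicke_zero_eq_dicke]

end DickeCircuit

theorem theorem1 :
    ∃ C : ℝ, ∀ n k : ℕ, 1 ≤ k → k ≤ n →
      ∃ c : DickeCircuit.Circuit n,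
        DickeCircuit.IsDickeStateUnitary n k c.toMatrix ∧
        (c.gateCount : ℝ) ≤ C * ((k : ℝ) * (n : ℝ)) ∧
        (2 * k ≤ n → (c.depth : ℝ) ≤ C * ((k : ℝ) * Real.logb 2 ((n : ℝ) / (k : ℝ)))) ∧
        (n < 2 * k → (c.depth : ℝ) ≤ C * (k : ℝ)) := by
  -- Here `1150 = 230 * 5`: for `L ≥ 1`, `3 + ⌈L⌉ ≤ 4 + L ≤ 5 L`. The case `n < 2 * k` takes `m = 1`
  -- and needs only 920.
  refine ⟨1150, fun n k hk hkn => ?_⟩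
  have hk0 : (0 : ℝ) < k := by exact_mod_cast hk
  have key : ∀ m : ℕ, n ≤ k * 2 ^ m → ∃ c : DickeCircuit.Circuit n,
      DickeCircuit.IsDickeStateUnitary n k c.toMatrix ∧
      (c.gateCount : ℝ) ≤ 1150 * ((k : ℝ) * (n : ℝ)) ∧
      (c.depth : ℝ) = 230 * (k * (3 + m)) := by
    intro m hm
    obtain ⟨F, hF, hR⟩ := DickeCircuit.realizable_of_le_mul_two_pow (N := n) (k := k) m n 0
      (hk.trans hkn) hm (by omega) (by omega)
    obtain ⟨c, hc, hcount, hdepth⟩ := hR.exists_circuit hkn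
    refine ⟨c, hc, ?_, ?_⟩
    · have : c.gateCount ≤ 1150 * (k * n) := by omega
      exact_mod_cast this
    · rw [hdepth]; push_cast; ring
  rcases Nat.lt_or_ge n (2 * k) with h | h
  · obtain ⟨c, hc, hcount, hdepth⟩ := key 1 (by omega)
    refine ⟨c, hc, hcount, fun h' => by omega, fun _ => ?_⟩
    rw [hdepth]
    push_cast
    linarith
  · set L := Real.logb 2 ((n : ℝ) / (k : ℝ)) with hL
    have hn0 : (0 : ℝ) < n := by exact_mod_cast hk.trans hkn
    have hL1 : 1 ≤ L := by
      rw [hL, Real.le_logb_iff_rpow_le one_lt_two (by positivity), Real.rpow_one,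
        le_div_iff₀ hk0]
      exact_mod_cast h
    have hpow : (n : ℝ) ≤ k * 2 ^ ⌈L⌉₊ := by
      have h1 : (n : ℝ) / k ≤ (2 : ℝ) ^ ((⌈L⌉₊ : ℕ) : ℝ) := by
        rw [← Real.logb_le_iff_le_rpow one_lt_two (by positivity)]
        exact Nat.le_ceil L
      rw [Real.rpow_natCast, div_le_iff₀ hk0] at h1
      linarith
    obtain ⟨c, hc, hcount, hdepth⟩ := key ⌈L⌉₊ (by exact_mod_cast hpow)
    refine ⟨c, hc, hcount, fun _ => ?_, fun h' => by omega⟩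
    have hceil := Nat.ceil_lt_add_one (show 0 ≤ L by linarith)
    rw [hdepth]
    have : (k : ℝ) * (3 + ⌈L⌉₊) ≤ k * (5 * L) :=
      mul_le_mul_of_nonneg_left (by linarith) hk0.le
    linarith
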